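/- Let $G$ be a finite group. For $n\geq 1$ let $\mathcal{T}_n(G)=\{\tau\subseteq G : 1\in\tau,\ |\tau|=n\}$, with the canonical partial action of $G$ given by $\tau\mapsto g\tau$ for $\tau\in\mathcal{T}_n(G)$ with $g^{-1}\in\tau$. Let $\mathcal{O}_n(G)$ be its orbit space, and choose for every $z\in\mathcal{O}_n(G)$ a representative $\tau_z\in\mathcal{T}_n(G)$ of the orbit $z$. Put $H_z=\{h\in G: h\tau_z=\tau_z\}$ and $m_z=\frac{n}{|H_z|}-1$. Let $C^*_{\mathrm{par}}(G)$ be the partial group $C^*$-algebra, that is, the universal unital $C^*$-algebra generated by elements $[g]$, $g\in G$, subject to $[1]=1$, $[g^{-1}]=[g]^*$ and $[g][h][h^{-1}]=[gh][h^{-1}]$ for all $g,h\in G$; and let $C^*(H_z)$ be the full group $C^*$-algebra of $H_z$, with canonical unitaries $v_h$, $h\in H_z$. Then for every $n$ and $z$ there are elements $x^z_0=1,x^z_1,\ldots,x^z_{m_z}\in G$ with $\tau_z=H_z\sqcup H_zx^z_1\sqcup\cdots\sqcup H_zx^z_{m_z}$, and for every choice of such elements there is a unique $*$-isomorphism \[\Phi\colon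 C^*_{\mathrm{par}}(G)\longrightarrow \bigoplus_{n=1}^{|G|}\ \bigoplus_{z\in\mathcal{O}_n(G)} M_{m_z+1}\big(C^*(H_z)\big)\] such that, for all $g\in G$, $1\leq n\leq |G|$, $z\in\mathcal{O}_n(G)$ and $0\leq j,k\leq m_z$, the $(j,k)$ entry of the $z$-component of $\Phi([g])$ is $v_{x^z_j g (x^z_k)^{-1}}$ if $x^z_j g (x^z_k)^{-1}\in H_z$, and $0$ otherwise. -/

import Mathlib

open scoped Pointwise

universe u

noncomputable section

/-! ## Universal unital C*-algebras given by generators and relations -/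

/-- Words in the letters `x` (encoded by `(x, false)`) and `x*` (encoded by `(x, true)`). -/
abbrev StarWord (X : Type u) : Type u := FreeMonoid (X × Bool)

namespace StarWord

variable {X : Type u}

/-- The adjoint of a word: reverse the order of the letters and exchange `x` and `x*`. -/
def adj (w : StarWord X) : StarWord X :=
  FreeMonoid.reverse (FreeMonoid.map (fun p : X × Bool => (p.1, !p.2)) w)

theorem adj_one : adj (1 : StarWord X) = 1 := rfl

theorem adj_mul (v w : StarWord X) : adj (v * w) = adj w * adj v := by
  simp [adj, FreeMonoid.reverse_mul]

theorem adj_of (p : X × Bool) : adj (FreeMonoid.of p) = FreeMonoid.of (p.1, !p.2) := rfl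

theorem adj_adj (w : StarWord X) : adj (adj w) = w := by
  induction w using FreeMonoid.inductionOn' with
  | one => rfl
  | of_mul p w ih => rw [adj_mul, adj_mul, ih, adj_of, adj_of]; simp

/-- The value of a word under an assignment of elements of a *-monoid to the letters. -/
def eval {B : Type*} [Monoid B] [StarMul B] (φ : X → B) : StarWord X →* B :=
  FreeMonoid.lift fun p => if p.2 then star (φ p.1) else φ p.1

theorem eval_adj {B : Type*} [Monoid B] [StarMul B] (φ : X → B) (w : StarWord X) :
    eval φ (adj w) = star (eval φ w) := by
  induction w using FreeMonoid.inductionOn' with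
  | one => simp [adj_one]
  | of_mul p w ih =>
    rw [adj_mul, map_mul, map_mul, star_mul, ih, adj_of]
    congr 1
    rcases p with ⟨x, _ | _⟩ <;> simp [eval]

end StarWord

/-- The free unital complex *-algebra on a set `X` of generators: complex linear combinations
of words in the letters `x` and `x*`. -/
def FreeStarAlgebra (X : Type u) : Type u := MonoidAlgebra ℂ (StarWord X)

namespace FreeStarAlgebra

variable {X : Type u}

instance : Ring (FreeStarAlgebra X) := inferInstanceAs (Ring (MonoidAlgebra ℂ (StarWord X)))

instance : Algebra ℂ (FreeStarAlgebra X) :=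
  inferInstanceAs (Algebra ℂ (MonoidAlgebra ℂ (StarWord X)))

/-- The scalar multiple `c • w` of a word `w`. -/
def mono (w : StarWord X) (c : ℂ) : FreeStarAlgebra X := MonoidAlgebra.single w c

/-- The generators. -/
def gen (x : X) : FreeStarAlgebra X := mono (FreeMonoid.of (x, false)) 1

theorem mono_mul (v w : StarWord X) (c d : ℂ) :
    mono v c * mono w d = mono (v * w) (c * d) :=
  MonoidAlgebra.single_mul_single ..

theorem smul_mono (w : StarWord X) (c d : ℂ) : c • mono w d = mono w (c * d) :=
  MonoidAlgebra.smul_single ..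

theorem induction_mono {p : FreeStarAlgebra X → Prop} (a : FreeStarAlgebra X)
    (zero : p 0) (add : ∀ a b, p a → p b → p (a + b)) (mono : ∀ w c, p (mono w c)) : p a :=
  MonoidAlgebra.induction_linear a zero add mono

/-- The conjugate linear map which sends each word to its adjoint. -/
def starHom : FreeStarAlgebra X →+ FreeStarAlgebra X where
  toFun a := MonoidAlgebra.ofCoeff
    ((Finsupp.mapRange.addMonoidHom (starAddEquiv (R := ℂ)).toAddMonoidHom
      (MonoidAlgebra.coeff a)).mapDomain StarWord.adj)
  map_zero' := by
    change MonoidAlgebra.ofCoeff (Finsupp.mapDomain _ (_ : StarWord X →₀ ℂ)) = _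
    rw [show MonoidAlgebra.coeff (0 : FreeStarAlgebra X) = 0 from rfl, map_zero,
      Finsupp.mapDomain_zero]
    rfl
  map_add' a b := by
    rw [show MonoidAlgebra.coeff (a + b) = MonoidAlgebra.coeff a + MonoidAlgebra.coeff b from rfl,
      map_add, Finsupp.mapDomain_add]
    rfl

theorem starHom_mono (w : StarWord X) (c : ℂ) :
    starHom (mono w c) = mono w.adj (star c) := by
  change MonoidAlgebra.ofCoeff (Finsupp.mapDomain StarWord.adj
    (Finsupp.mapRange star (star_zero ℂ) (Finsupp.single w c))) = _
  rw [Finsupp.mapRange_single, Finsupp.mapDomain_single]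
  rfl

instance : StarRing (FreeStarAlgebra X) where
  star := starHom
  star_involutive a := by
    induction a using induction_mono with
    | zero => simp
    | add a b ha hb => rw [map_add, map_add, ha, hb]
    | mono w c => rw [starHom_mono, starHom_mono, StarWord.adj_adj, star_star]
  star_mul a b := by
    change starHom (a * b) = starHom b * starHom a
    induction a using induction_mono with
    | zero => simp
    | add a a' ha ha' => rw [add_mul, map_add, map_add, ha, ha', mul_add]
    | mono w c =>
      induction b using induction_mono with
      | zero => simp
      | add b b' hb hb' => rw [mul_add, map_add, map_add, hb, hb', add_mul]
      | mono v d =>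
        rw [mono_mul, starHom_mono, starHom_mono, starHom_mono, mono_mul, StarWord.adj_mul,
          star_mul]
  star_add a b := map_add starHom a b

theorem star_mono (w : StarWord X) (c : ℂ) : star (mono w c) = mono w.adj (star c) :=
  starHom_mono w c

instance : StarModule ℂ (FreeStarAlgebra X) where
  star_smul c a := by
    induction a using induction_mono with
    | zero => simp
    | add a b ha hb => rw [smul_add, star_add, star_add, ha, hb, smul_add]
    | mono w d => rw [smul_mono, star_mono, star_mono, smul_mono, star_mul, mul_comm]

/-- The unital *-homomorphism which extends a map on the generators. -/
def eval {B : Type*} [Ring B] [StarRing B] [Algebra ℂ B] [StarModule ℂ B] (φ : X → B) :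
    FreeStarAlgebra X →⋆ₐ[ℂ] B where
  __ := (MonoidAlgebra.lift ℂ B (StarWord X) (StarWord.eval φ) :
    MonoidAlgebra ℂ (StarWord X) →ₐ[ℂ] B)
  map_star' a := by
    let f : FreeStarAlgebra X →ₐ[ℂ] B :=
      (MonoidAlgebra.lift ℂ B (StarWord X) (StarWord.eval φ) : MonoidAlgebra ℂ (StarWord X) →ₐ[ℂ] B)
    have hf : ∀ w c, f (mono w c) = c • StarWord.eval φ w :=
      fun w c => MonoidAlgebra.lift_single _ _ _
    change f (star a) = star (f a)
    induction a using induction_mono with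
    | zero => simp
    | add a b ha hb => rw [star_add, map_add, map_add, ha, hb, star_add]
    | mono w c => rw [star_mono, hf, hf, StarWord.eval_adj, star_smul]

theorem eval_mono {B : Type*} [Ring B] [StarRing B] [Algebra ℂ B] [StarModule ℂ B] (φ : X → B)
    (w : StarWord X) (c : ℂ) : eval φ (mono w c) = c • StarWord.eval φ w :=
  MonoidAlgebra.lift_single _ _ _

theorem eval_gen {B : Type*} [Ring B] [StarRing B] [Algebra ℂ B] [StarModule ℂ B] (φ : X → B)
    (x : X) : eval φ (gen x) = φ x := by
  simp [gen, eval_mono, StarWord.eval]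

end FreeStarAlgebra

/-- A set of relations for a universal unital C*-algebra with generators `X`: a condition on maps
from `X` to unital C*-algebras which forces a uniform bound on the norm of each generator. -/
structure CStarRelations (X : Type u) where
  /-- `Holds φ` says that the elements `φ x` satisfy the relations. -/
  Holds : ∀ {B : Type u} [CStarAlgebra B], (X → B) → Prop
  bounded : ∃ C : X → ℝ, ∀ {B : Type u} [CStarAlgebra B] (φ : X → B), Holds φ → ∀ x, ‖φ x‖ ≤ C x

/-- A representation of the relations in a unital C*-algebra. -/
structure CStarRelations.Rep {X : Type u} (R : CStarRelations X) where
  carrier : Type u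
  [cstar : CStarAlgebra carrier]
  toFun : X → carrier
  holds : R.Holds toFun

attribute [instance] CStarRelations.Rep.cstar

/-- The free unital *-algebra on `X`, to be equipped with the universal C*-seminorm. -/
def PreUniversal {X : Type u} (_R : CStarRelations X) : Type u := FreeStarAlgebra X

namespace PreUniversal

variable {X : Type u} (R : CStarRelations X)

instance : Ring (PreUniversal R) := inferInstanceAs (Ring (FreeStarAlgebra X))
instance : Algebra ℂ (PreUniversal R) := inferInstanceAs (Algebra ℂ (FreeStarAlgebra X))
instance : StarRing (PreUniversal R) := inferInstanceAs (StarRing (FreeStarAlgebra X))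
instance : StarModule ℂ (PreUniversal R) := inferInstanceAs (StarModule ℂ (FreeStarAlgebra X))

/-- The generators. -/
def gen (x : X) : PreUniversal R := FreeStarAlgebra.gen x

variable {R}

/-- The *-homomorphism defined by a representation of the relations. -/
def eval (ρ : R.Rep) : PreUniversal R →⋆ₐ[ℂ] ρ.carrier := FreeStarAlgebra.eval ρ.toFun

theorem eval_gen (ρ : R.Rep) (x : X) : eval ρ (gen R x) = ρ.toFun x :=
  FreeStarAlgebra.eval_gen _ _

/-- The universal C*-seminorm: the supremum of `‖ρ(a)‖` over all representations `ρ` of the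
relations in unital C*-algebras. -/
def univNorm (a : PreUniversal R) : ℝ := ⨆ ρ : R.Rep, ‖eval ρ a‖

theorem bddAbove (a : PreUniversal R) : BddAbove (Set.range fun ρ : R.Rep => ‖eval ρ a‖) := by
  obtain ⟨C, hC⟩ := R.bounded
  suffices h : ∃ K : ℝ, ∀ ρ : R.Rep, ‖eval ρ a‖ ≤ K by
    obtain ⟨K, hK⟩ := h
    exact ⟨K, by rintro _ ⟨ρ, rfl⟩; exact hK ρ⟩
  induction a using FreeStarAlgebra.induction_mono with
  | zero => exact ⟨0, fun ρ => (congrArg norm (map_zero (eval ρ))).le.trans norm_zero.le⟩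
  | add a b ha hb =>
    obtain ⟨K, hK⟩ := ha
    obtain ⟨L, hL⟩ := hb
    exact ⟨K + L, fun ρ => (congrArg norm (map_add (eval ρ) a b)).le.trans
      (norm_add_le_of_le (hK ρ) (hL ρ))⟩
  | mono w c =>
    have hw : ∃ K : ℝ, ∀ ρ : R.Rep, ‖StarWord.eval ρ.toFun w‖ ≤ K := by
      induction w using FreeMonoid.inductionOn' with
      | one =>
        refine ⟨1, fun ρ => ?_⟩
        rw [map_one]
        rcases subsingleton_or_nontrivial ρ.carrier with h | h
        · rw [Subsingleton.elim (1 : ρ.carrier) 0, norm_zero]; exact zero_le_one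
        · exact CStarRing.norm_one.le
      | of_mul p w ih =>
        obtain ⟨K, hK⟩ := ih
        refine ⟨C p.1 * K, fun ρ => ?_⟩
        rw [map_mul]
        refine norm_mul_le_of_le ?_ (hK ρ)
        rcases p with ⟨x, _ | _⟩ <;> simpa [StarWord.eval] using hC ρ.toFun ρ.holds x
    obtain ⟨K, hK⟩ := hw
    exact ⟨‖c‖ * K, fun ρ => (congrArg norm (FreeStarAlgebra.eval_mono ρ.toFun w c)).le.trans
      ((norm_smul_le _ _).trans (mul_le_mul_of_nonneg_left (hK ρ) (norm_nonneg c)))⟩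

theorem le_univNorm (ρ : R.Rep) (a : PreUniversal R) : ‖eval ρ a‖ ≤ univNorm a :=
  le_ciSup (bddAbove a) ρ

theorem univNorm_nonneg (a : PreUniversal R) : 0 ≤ univNorm a :=
  Real.iSup_nonneg fun _ => norm_nonneg _

theorem univNorm_le {a : PreUniversal R} {K : ℝ} (h : ∀ ρ : R.Rep, ‖eval ρ a‖ ≤ K) (hK : 0 ≤ K) :
    univNorm a ≤ K :=
  Real.iSup_le h hK

/-- The universal C*-seminorm as a ring seminorm. -/
def univSeminorm (R : CStarRelations X) : RingSeminorm (PreUniversal R) where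
  toFun := univNorm
  map_zero' := le_antisymm (univNorm_le (fun ρ => by simp) le_rfl) (univNorm_nonneg _)
  add_le' a b := univNorm_le (fun ρ => by
    rw [map_add]; exact norm_add_le_of_le (le_univNorm ρ a) (le_univNorm ρ b))
    (add_nonneg (univNorm_nonneg a) (univNorm_nonneg b))
  neg' a := by simp [univNorm]
  mul_le' a b := univNorm_le (fun ρ => by
    rw [map_mul]; exact norm_mul_le_of_le (le_univNorm ρ a) (le_univNorm ρ b))
    (mul_nonneg (univNorm_nonneg a) (univNorm_nonneg b))

instance : SeminormedRing (PreUniversal R) := (univSeminorm R).toSeminormedRing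

theorem norm_def (a : PreUniversal R) : ‖a‖ = univNorm a := rfl

instance : NormedSpace ℂ (PreUniversal R) where
  norm_smul_le c a := univNorm_le (fun ρ => by
    rw [map_smul, norm_smul]
    exact mul_le_mul_of_nonneg_left (le_univNorm ρ a) (norm_nonneg c))
    (mul_nonneg (norm_nonneg c) (univNorm_nonneg a))

instance : NormedStarGroup (PreUniversal R) where
  norm_star_le a := univNorm_le (fun ρ => by
    rw [map_star, norm_star]; exact le_univNorm ρ a) (univNorm_nonneg a)

theorem norm_mul_self_le (a : PreUniversal R) : ‖a‖ * ‖a‖ ≤ ‖star a * a‖ := by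
    have h : ‖a‖ ≤ √‖star a * a‖ := univNorm_le (fun ρ => by
      refine Real.le_sqrt_of_sq_le ?_
      have := le_univNorm ρ (star a * a)
      rwa [map_mul, map_star, CStarRing.norm_star_mul_self, ← pow_two] at this)
      (Real.sqrt_nonneg _)
    calc ‖a‖ * ‖a‖ ≤ √‖star a * a‖ * √‖star a * a‖ :=
          mul_self_le_mul_self (norm_nonneg a) h
      _ = ‖star a * a‖ := Real.mul_self_sqrt (norm_nonneg _)

end PreUniversal

/-- The universal unital C*-algebra on the generators `X` with the relations `R`: the Hausdorff
completion of the free unital *-algebra on `X` in the universal C*-seminorm. -/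
def UniversalCStarAlgebra {X : Type u} (R : CStarRelations X) : Type u :=
  UniformSpace.Completion (PreUniversal R)

namespace UniversalCStarAlgebra

open UniformSpace

variable {X : Type u} (R : CStarRelations X)

instance : NormedRing (UniversalCStarAlgebra R) :=
  inferInstanceAs (NormedRing (Completion (PreUniversal R)))

instance : CompleteSpace (UniversalCStarAlgebra R) :=
  inferInstanceAs (CompleteSpace (Completion (PreUniversal R)))

instance : NormedAlgebra ℂ (UniversalCStarAlgebra R) where
  __ := (inferInstanceAs (Algebra ℂ (Completion (PreUniversal R))) :
    Algebra ℂ (UniversalCStarAlgebra R))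
  norm_smul_le c a := norm_smul_le c (show Completion (PreUniversal R) from a)

variable {R}

/-- The canonical *-algebra map to the completion. -/
def coe (a : PreUniversal R) : UniversalCStarAlgebra R := (a : Completion (PreUniversal R))

theorem induction_coe {p : UniversalCStarAlgebra R → Prop} (a : UniversalCStarAlgebra R)
    (hp : IsClosed {a | p a}) (ih : ∀ a : PreUniversal R, p (coe a)) : p a :=
  Completion.induction_on (α := PreUniversal R) a hp ih

instance : Star (UniversalCStarAlgebra R) where
  star := Completion.map (star : PreUniversal R → PreUniversal R)

theorem star_coe (a : PreUniversal R) : star (coe a) = coe (star a) :=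
  Completion.map_coe (star_isometry (E := PreUniversal R)).uniformContinuous a

instance : ContinuousStar (UniversalCStarAlgebra R) where
  continuous_star := Completion.continuous_map (α := PreUniversal R) (β := PreUniversal R)

theorem coe_add (a b : PreUniversal R) : coe (a + b) = coe a + coe b := Completion.coe_add a b

theorem coe_mul (a b : PreUniversal R) : coe (a * b) = coe a * coe b := Completion.coe_mul a b

theorem coe_smul (c : ℂ) (a : PreUniversal R) : coe (c • a) = c • coe a := Completion.coe_smul c a

theorem norm_coe (a : PreUniversal R) : ‖coe a‖ = ‖a‖ := Completion.norm_coe a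

instance : StarRing (UniversalCStarAlgebra R) where
  star_involutive a := by
    induction a using induction_coe with
    | hp => exact isClosed_eq (by fun_prop) (by fun_prop)
    | ih a => rw [star_coe, star_coe, star_star]
  star_mul a b := by
    induction a using induction_coe with
    | hp => exact isClosed_eq (by fun_prop) (by fun_prop)
    | ih a =>
      induction b using induction_coe with
      | hp => exact isClosed_eq (by fun_prop) (by fun_prop)
      | ih b => rw [← coe_mul, star_coe, star_coe, star_coe, star_mul, coe_mul]
  star_add a b := by
    induction a using induction_coe with
    | hp => exact isClosed_eq (by fun_prop) (by fun_prop)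
    | ih a =>
      induction b using induction_coe with
      | hp => exact isClosed_eq (by fun_prop) (by fun_prop)
      | ih b => rw [← coe_add, star_coe, star_coe, star_coe, star_add, coe_add]

instance : CStarRing (UniversalCStarAlgebra R) where
  norm_mul_self_le a := by
    induction a using induction_coe with
    | hp => exact isClosed_le (by fun_prop) (by fun_prop)
    | ih a =>
      rw [star_coe, ← coe_mul, norm_coe, norm_coe]
      exact PreUniversal.norm_mul_self_le a

instance : StarModule ℂ (UniversalCStarAlgebra R) where
  star_smul c a := by
    induction a using induction_coe with
    | hp =>
      exact isClosed_eq (continuous_star.comp (continuous_const_smul c))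
        ((continuous_const_smul (star c)).comp continuous_star)
    | ih a => rw [← coe_smul, star_coe, star_coe, star_smul, coe_smul]

instance : CStarAlgebra (UniversalCStarAlgebra R) where

/-- The canonical generators of the universal C*-algebra. -/
def gen (R : CStarRelations X) (x : X) : UniversalCStarAlgebra R :=
  coe (PreUniversal.gen R x)

end UniversalCStarAlgebra

/-! ## Group C*-algebras and partial group C*-algebras -/

/-- A *-partial representation of a group in a unital C*-algebra. -/
structure IsPartialRep {G : Type*} [Group G] {B : Type*} [CStarAlgebra B] (π : G → B) : Prop where
  map_one : π 1 = 1
  map_inv : ∀ g, π g⁻¹ = star (π g)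
  map_mul : ∀ g h, π g * π h * π h⁻¹ = π (g * h) * π h⁻¹

/-- A unitary representation of a group in a unital C*-algebra. -/
structure IsUnitaryRep {G : Type*} [Group G] {B : Type*} [CStarAlgebra B] (π : G → B) : Prop where
  map_one : π 1 = 1
  map_mul : ∀ g h, π (g * h) = π g * π h
  mem_unitary : ∀ g, π g ∈ unitary B

theorem CStarAlgebra.norm_le_one_of_mul_star_mul {B : Type*} [CStarAlgebra B] {a : B}
    (ha : a * star a * a = a) : ‖a‖ ≤ 1 := by
  have h1 : (star a * a) * (star a * a) = star a * a := by
    rw [mul_assoc, ← mul_assoc a, ha]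
  have h2 : ‖star a * a‖ * ‖star a * a‖ = ‖star a * a‖ := by
    have := CStarRing.norm_star_mul_self (x := star a * a)
    rw [star_mul, star_star, h1] at this
    exact this.symm
  rw [CStarRing.norm_star_mul_self] at h2
  have h3 : ‖a‖ * ‖a‖ ≤ 1 := by
    by_contra! h
    nlinarith [mul_pos (sub_pos.2 h) (sub_pos.2 h)]
  by_contra! h
  nlinarith

theorem IsPartialRep.norm_le_one {G : Type*} [Group G] {B : Type*} [CStarAlgebra B] {π : G → B}
    (h : IsPartialRep π) (g : G) : ‖π g‖ ≤ 1 := by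
  refine CStarAlgebra.norm_le_one_of_mul_star_mul ?_
  have := h.map_mul g g⁻¹
  rwa [inv_inv, mul_inv_cancel, h.map_one, one_mul, h.map_inv] at this

theorem IsUnitaryRep.norm_le_one {G : Type*} [Group G] {B : Type*} [CStarAlgebra B] {π : G → B}
    (h : IsUnitaryRep π) (g : G) : ‖π g‖ ≤ 1 :=
  CStarAlgebra.norm_le_one_of_mul_star_mul (by
    rw [Unitary.mul_star_self_of_mem (h.mem_unitary g), one_mul])

/-- The relations which say that the generators form a *-partial representation of `G`. -/
def partialRepRelations (G : Type u) [Group G] : CStarRelations G where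
  Holds π := IsPartialRep π
  bounded := ⟨fun _ => 1, fun _ h => h.norm_le_one⟩

/-- The relations which say that the generators form a unitary representation of `G`. -/
def unitaryRepRelations (G : Type u) [Group G] : CStarRelations G where
  Holds π := IsUnitaryRep π
  bounded := ⟨fun _ => 1, fun _ h => h.norm_le_one⟩

/-- The partial group C*-algebra of a discrete group. -/
abbrev PartialGroupCStar (G : Type u) [Group G] : Type u :=
  UniversalCStarAlgebra (partialRepRelations G)

/-- The (full) group C*-algebra of a discrete group. -/
abbrev GroupCStar (G : Type u) [Group G] : Type u :=
  UniversalCStarAlgebra (unitaryRepRelations G)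

/-- The canonical generators of the partial group C*-algebra. -/
def PartialGroupCStar.of {G : Type u} [Group G] (g : G) : PartialGroupCStar G :=
  UniversalCStarAlgebra.gen (partialRepRelations G) g

/-- The canonical unitaries in the group C*-algebra. -/
def GroupCStar.of {G : Type u} [Group G] (g : G) : GroupCStar G :=
  UniversalCStarAlgebra.gen (unitaryRepRelations G) g

/-! ## The spaces of `n`-tuples of a group -/

/-- The space of `n`-tuples of `G`: the subsets of `G` with `n` elements which contain `1`. -/
def TupleSpace (G : Type u) [Group G] (n : ℕ) : Type u :=
  {τ : Set G // 1 ∈ τ ∧ τ.encard = n}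

namespace TupleSpace

variable {G : Type u} [Group G] {n : ℕ}

/-- The domain `{τ | g ∈ τ}` of the canonical partial action. -/
def dom (n : ℕ) (g : G) : Set (TupleSpace G n) := {τ | g ∈ τ.1}

/-- The canonical partial action: for `g⁻¹ ∈ τ`, the tuple `g τ`, which contains `g`. -/
def lt (g : G) (τ : dom (G := G) n g⁻¹) : dom (G := G) n g :=
  ⟨⟨g • τ.1.1, by
      refine ⟨?_, ?_⟩
      · exact ⟨g⁻¹, τ.2, by simp⟩
      · exact (((MulAction.injective g).injOn).encard_image).trans τ.1.2.2⟩,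
    ⟨1, τ.1.2.1, by simp⟩⟩

/-- Two tuples lie in the same orbit of the canonical partial action. -/
def orbitSetoid (G : Type u) [Group G] (n : ℕ) : Setoid (TupleSpace G n) where
  r τ σ := ∃ (g : G) (h : τ ∈ dom n g⁻¹), (lt g ⟨τ, h⟩).1 = σ
  iseqv :=
    { refl := fun τ => ⟨1, by simp [dom, τ.2.1], Subtype.ext (one_smul G τ.1)⟩
      symm := by
        rintro τ _ ⟨g, h, rfl⟩
        refine ⟨g⁻¹, ?_, Subtype.ext (inv_smul_smul g τ.1)⟩
        rw [inv_inv]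
        exact (lt g ⟨τ, h⟩).2
      trans := by
        rintro τ _ _ ⟨g, h, rfl⟩ ⟨k, h', rfl⟩
        refine ⟨k * g, ?_, Subtype.ext (mul_smul k g τ.1)⟩
        have h2 : k⁻¹ ∈ g • τ.1 := h'
        rw [Set.mem_smul_set_iff_inv_smul_mem] at h2
        simpa [dom] using h2 }

/-- The subgroup `H_τ = {h | h τ = τ}`. -/
def stab (τ : TupleSpace G n) : Subgroup G := MulAction.stabilizer G τ.1

/-- The number `m_τ = n / |H_τ| - 1`. -/
def mult (τ : TupleSpace G n) : ℕ := n / Nat.card τ.stab - 1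

/-- The elements `x 0 = 1, x 1, …, x m_τ` decompose `τ` as the disjoint union of the right cosets
`H_τ x j`. -/
structure IsDecomposition (τ : TupleSpace G n) (x : Fin (τ.mult + 1) → G) : Prop where
  zero : x 0 = 1
  union : τ.1 = ⋃ j, (fun h => h * x j) '' (τ.stab : Set G)
  disjoint : Pairwise fun j k =>
    Disjoint ((fun h => h * x j) '' (τ.stab : Set G)) ((fun h => h * x k) '' (τ.stab : Set G))

end TupleSpace

/-- The orbit space of the canonical partial action of `G` on its `n`-tuples. -/
def TupleOrbits (G : Type u) [Group G] (n : ℕ) : Type u := Quotient (TupleSpace.orbitSetoid G n)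

/-- The canonical quotient map. -/
def TupleOrbits.mk {G : Type u} [Group G] {n : ℕ} (τ : TupleSpace G n) : TupleOrbits G n :=
  Quotient.mk (TupleSpace.orbitSetoid G n) τ

end

/-! For a partial representation `π` of `G` the projections `ε g = π g * π g⁻¹` commute. For finite
`G`, multiplying each `ε g` (`g ∈ τ`) and each `1 - ε g` (`g ∉ τ`) gives atoms `P_τ`, which sum to
`1`. Three rules govern them: `π g * P_τ = P_{gτ} * π g`; `P_τ * π g = 0` unless `1, g ∈ τ`; and
`P_τ * π g * π h = P_τ * π (g * h)` when `g ∈ τ`. Hence the partial group algebra is the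
finite-dimensional span of the `P_τ * π g` with `1, g ∈ τ` (`span_atom_mul_of`). Every such pair has
the form `τ = x_j⁻¹ τ_z`, `g = x_j⁻¹ h x_k` with `h ∈ H_z` (`exists_eq_smul`), and the corresponding
element plays the role of `v_h` in entry `(j, k)` of block `z`.

The prescribed matrices form a partial representation (`IsDecomposition.isPartialRep`), so the
universal property yields the homomorphism. It sends these spanning elements to the matrices with
single entry `v_h`, whence surjectivity. For injectivity, compression by `P_{τ_z}` defines a map
from `C*(H_z)` back to the partial group algebra (`ofStab`), and a sum over matrix entries recovers
each element from its image. Linear independence of the `v_h` is never needed. -/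

/-! ### Universal property and finite-dimensional spanning sets -/

namespace UniversalCStarAlgebra

open UniformSpace

variable {X : Type u} {R : CStarRelations X}

theorem continuous_eval (ρ : R.Rep) : Continuous (PreUniversal.eval ρ) :=
  AddMonoidHomClass.continuous_of_bound (PreUniversal.eval ρ) 1 fun a => by
    rw [one_mul]; exact PreUniversal.le_univNorm ρ a

/-- The *-homomorphism from the universal C*-algebra which a representation of the relations
induces. -/
noncomputable def lift (ρ : R.Rep) : UniversalCStarAlgebra R →⋆ₐ[ℂ] ρ.carrier :=
  let f : UniversalCStarAlgebra R →+* ρ.carrier :=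
    Completion.extensionHom (PreUniversal.eval ρ : PreUniversal R →+* ρ.carrier) (continuous_eval ρ)
  have hf : ∀ a, f (coe a) = PreUniversal.eval ρ a := fun a =>
    Completion.extensionHom_coe _ (continuous_eval ρ) a
  have hfc : Continuous f := Completion.continuous_extension
  { f with
    commutes' := fun c => by
      have h := hf (algebraMap ℂ (PreUniversal R) c)
      rw [AlgHomClass.commutes] at h
      exact h
    map_star' := fun a => by
      change f (star a) = star (f a)
      induction a using induction_coe with
      | hp => exact isClosed_eq (hfc.comp continuous_star) (continuous_star.comp hfc)
      | ih a => rw [star_coe, hf, hf, map_star] }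

theorem lift_coe (ρ : R.Rep) (a : PreUniversal R) : lift ρ (coe a) = PreUniversal.eval ρ a :=
  Completion.extensionHom_coe (α := PreUniversal R)
    (PreUniversal.eval ρ : PreUniversal R →+* ρ.carrier) (continuous_eval ρ) a

theorem lift_gen (ρ : R.Rep) (x : X) : lift ρ (gen R x) = ρ.toFun x := by
  rw [gen, lift_coe, PreUniversal.eval_gen]

/-- The difference has universal seminorm zero, so it dies in the Hausdorff completion. Relations
that hold in every representation thereby pass to the canonical generators. -/
theorem coe_eq_coe {a b : PreUniversal R}
    (h : ∀ ρ : R.Rep, PreUniversal.eval ρ a = PreUniversal.eval ρ b) : coe a = coe b := by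
  have h0 : ‖a - b‖ ≤ 0 := PreUniversal.univNorm_le (fun ρ => by
    rw [map_sub, h ρ, sub_self, norm_zero]) le_rfl
  have h1 : coe (a - b) = 0 := by
    rw [← norm_le_zero_iff, norm_coe]; exact h0
  rw [← sub_add_cancel a b, coe_add, h1, zero_add]

theorem coe_one : coe (1 : PreUniversal R) = 1 := rfl

/-- The scalar multiple `c • w` of a word `w`, in the universal C*-algebra. -/
noncomputable def mono (R : CStarRelations X) (w : StarWord X) (c : ℂ) : UniversalCStarAlgebra R :=
  coe (FreeStarAlgebra.mono w c : FreeStarAlgebra X)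

theorem smul_mono (w : StarWord X) (c d : ℂ) : c • mono R w d = mono R w (c * d) :=
  (coe_smul (R := R) c (FreeStarAlgebra.mono w d : FreeStarAlgebra X)).symm.trans
    (congrArg coe (FreeStarAlgebra.smul_mono w c d))

theorem mono_mul (v w : StarWord X) (c d : ℂ) :
    mono R v c * mono R w d = mono R (v * w) (c * d) :=
  (coe_mul (R := R) (FreeStarAlgebra.mono v c : FreeStarAlgebra X)
    (FreeStarAlgebra.mono w d : FreeStarAlgebra X)).symm.trans
    (congrArg coe (FreeStarAlgebra.mono_mul v w c d))

theorem star_mono (w : StarWord X) (c : ℂ) : star (mono R w c) = mono R w.adj (star c) :=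
  (star_coe (R := R) (FreeStarAlgebra.mono w c : FreeStarAlgebra X)).trans
    (congrArg coe (FreeStarAlgebra.star_mono w c))

/-- A finite-dimensional subspace which contains `1` and is invariant under left multiplication
by the generators and their adjoints is everything. -/
theorem submodule_eq_top (S : Submodule ℂ (UniversalCStarAlgebra R)) [FiniteDimensional ℂ S]
    (h1 : 1 ∈ S) (hg : ∀ x, ∀ a ∈ S, gen R x * a ∈ S) (hs : ∀ x, ∀ a ∈ S, star (gen R x) * a ∈ S) :
    S = ⊤ := by
  have hm : ∀ w c, mono R w c ∈ S := fun w c => by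
    rw [← mul_one c, ← smul_mono]
    refine S.smul_mem c ?_
    induction w using FreeMonoid.inductionOn' with
    | one => exact h1
    | of_mul p w ih =>
      rw [← mul_one (1 : ℂ), ← mono_mul]
      rcases p with ⟨x, _ | _⟩
      · exact hg x _ ih
      · have := hs x _ ih
        rwa [show gen R x = mono R (FreeMonoid.of (x, false)) 1 from rfl, star_mono, star_one,
          StarWord.adj_of] at this
  refine Submodule.eq_top_iff'.2 fun a => ?_
  -- A finite-dimensional subspace is closed, so it suffices that `S` contains the dense image of
  -- the linear combinations of words.
  induction a using induction_coe with
  | hp => exact S.closed_of_finiteDimensional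
  | ih a =>
    refine FreeStarAlgebra.induction_mono (p := fun a => coe (R := R) a ∈ S) a S.zero_mem
      (fun a b ha hb => ?_) hm
    exact (coe_add (R := R) a b) ▸ S.add_mem ha hb

end UniversalCStarAlgebra

/-! ### The canonical representations -/

theorem PartialGroupCStar.isPartialRep (G : Type u) [Group G] :
    IsPartialRep (PartialGroupCStar.of : G → PartialGroupCStar G) where
  map_one := UniversalCStarAlgebra.coe_eq_coe fun ρ => by
    rw [PreUniversal.eval_gen, map_one]; exact ρ.holds.map_one
  map_inv g := by
    rw [of, of, UniversalCStarAlgebra.gen, UniversalCStarAlgebra.gen,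
      UniversalCStarAlgebra.star_coe]
    refine UniversalCStarAlgebra.coe_eq_coe fun ρ => ?_
    rw [map_star, PreUniversal.eval_gen, PreUniversal.eval_gen]; exact ρ.holds.map_inv g
  map_mul g h := by
    simp only [of, UniversalCStarAlgebra.gen, ← UniversalCStarAlgebra.coe_mul]
    refine UniversalCStarAlgebra.coe_eq_coe fun ρ => ?_
    simp only [map_mul, PreUniversal.eval_gen]
    exact ρ.holds.map_mul g h

theorem GroupCStar.isUnitaryRep (G : Type u) [Group G] :
    IsUnitaryRep (GroupCStar.of : G → GroupCStar G) where
  map_one := UniversalCStarAlgebra.coe_eq_coe fun ρ => by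
    rw [PreUniversal.eval_gen, map_one]; exact ρ.holds.map_one
  map_mul g h := by
    simp only [of, UniversalCStarAlgebra.gen, ← UniversalCStarAlgebra.coe_mul]
    refine UniversalCStarAlgebra.coe_eq_coe fun ρ => ?_
    simp only [map_mul, PreUniversal.eval_gen]
    exact ρ.holds.map_mul g h
  mem_unitary g := by
    rw [Unitary.mem_iff, of, UniversalCStarAlgebra.gen, UniversalCStarAlgebra.star_coe,
      ← UniversalCStarAlgebra.coe_mul, ← UniversalCStarAlgebra.coe_mul,
      ← UniversalCStarAlgebra.coe_one]
    constructor <;> refine UniversalCStarAlgebra.coe_eq_coe fun ρ => ?_ <;>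
      rw [map_mul, map_star, PreUniversal.eval_gen, map_one]
    · exact Unitary.star_mul_self_of_mem (ρ.holds.mem_unitary g)
    · exact Unitary.mul_star_self_of_mem (ρ.holds.mem_unitary g)

theorem IsUnitaryRep.map_inv {G : Type*} [Group G] {B : Type*} [CStarAlgebra B] {π : G → B}
    (hπ : IsUnitaryRep π) (g : G) : π g⁻¹ = star (π g) := by
  have h : π g⁻¹ * π g = 1 := by rw [← hπ.map_mul, inv_mul_cancel, hπ.map_one]
  exact left_inv_eq_right_inv h (Unitary.mul_star_self_of_mem (hπ.mem_unitary g))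

/-- The canonical unitaries of a finite group span its group C*-algebra. -/
theorem GroupCStar.span_of (H : Type u) [Group H] [Finite H] :
    Submodule.span ℂ (Set.range (GroupCStar.of : H → GroupCStar H)) = ⊤ := by
  set S := Submodule.span ℂ (Set.range (GroupCStar.of : H → GroupCStar H)) with hS
  have hu := GroupCStar.isUnitaryRep H
  have : FiniteDimensional ℂ S := FiniteDimensional.span_of_finite ℂ (Set.finite_range _)
  have hg : ∀ (x : H), ∀ a ∈ S, of x * a ∈ S := fun x a ha => by
    induction ha using Submodule.span_induction with
    | mem a ha =>
      obtain ⟨y, rfl⟩ := ha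
      rw [← hu.map_mul]
      exact Submodule.subset_span ⟨_, rfl⟩
    | zero => rw [mul_zero]; exact S.zero_mem
    | add a b _ _ ha hb => rw [mul_add]; exact S.add_mem ha hb
    | smul c a _ ha => rw [mul_smul_comm]; exact S.smul_mem c ha
  refine UniversalCStarAlgebra.submodule_eq_top S ?_ hg fun x a ha => ?_
  · rw [← hu.map_one]
    exact Submodule.subset_span ⟨1, rfl⟩
  · have := hg x⁻¹ a ha
    rwa [hu.map_inv] at this

/-! ### Atoms of a commuting family -/

section Atoms

open Classical in
/-- The product of the `ε g` with `g ∈ s ∩ τ` and the `1 - ε g` with `g ∈ s \ τ`. -/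
noncomputable def atom {G B : Type*} [Ring B] (ε : G → B) (hε : ∀ g h, Commute (ε g) (ε h))
    (s : Finset G) (τ : Set G) : B :=
  s.noncommProd (fun g => if g ∈ τ then ε g else 1 - ε g) <| by
    intro g _ h _ _
    have hgh := hε g h
    dsimp only [Function.onFun]
    split_ifs
    · exact hgh
    · exact (Commute.one_right _).sub_right hgh
    · exact (Commute.one_left _).sub_left hgh
    · exact (Commute.one_left _).sub_left ((Commute.one_right _).sub_right hgh)

variable {G B : Type*} [Ring B] {ε : G → B} {hε : ∀ g h, Commute (ε g) (ε h)}

theorem atom_empty (τ : Set G) : atom ε hε ∅ τ = 1 := Finset.noncommProd_empty _ _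

open Classical in
theorem atom_insert {s : Finset G} {g : G} (hg : g ∉ s) (τ : Set G) :
    atom ε hε (insert g s) τ = (if g ∈ τ then ε g else 1 - ε g) * atom ε hε s τ :=
  Finset.noncommProd_insert_of_notMem _ _ _ _ hg

theorem atom_congr {s : Finset G} {τ σ : Set G} (h : ∀ g ∈ s, (g ∈ τ ↔ g ∈ σ)) :
    atom ε hε s τ = atom ε hε s σ := by
  classical
  exact Finset.noncommProd_congr rfl (fun g hg => if_congr (h g hg) rfl rfl) _

theorem map_atom {C F : Type*} [Ring C] [FunLike F B C] [RingHomClass F B C] (f : F)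
    {ε' : G → C} (hε' : ∀ g h, Commute (ε' g) (ε' h)) (h : ∀ g, f (ε g) = ε' g)
    (s : Finset G) (τ : Set G) : f (atom ε hε s τ) = atom ε' hε' s τ := by
  refine (Finset.map_noncommProd _ _ _ f).trans (Finset.noncommProd_congr rfl (fun g _ => ?_) _)
  split_ifs
  · exact h g
  · rw [map_sub, map_one, h]

/-- An element on which each `ε g` acts as `1` for `g ∈ σ` and as `0` for `g ∉ σ` is fixed by
the atom of `σ`. -/
theorem atom_mul_of_eq {a : B} {s : Finset G} {σ : Set G} (h1 : ∀ g ∈ σ, ε g * a = a)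
    (h0 : ∀ g ∉ σ, ε g * a = 0) : atom ε hε s σ * a = a := by
  classical
  induction s using Finset.induction_on with
  | empty => rw [atom_empty, one_mul]
  | insert g s hg ih =>
    rw [atom_insert hg, mul_assoc, ih]
    split_ifs with h
    · exact h1 g h
    · rw [sub_mul, one_mul, h0 g h, sub_zero]

theorem commute_atom {b : B} (h : ∀ g, Commute b (ε g)) (s : Finset G) (τ : Set G) :
    Commute b (atom ε hε s τ) := by
  refine Finset.noncommProd_commute _ _ _ _ fun g _ => ?_
  split_ifs
  · exact h g
  · exact (Commute.one_right _).sub_right (h g)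

theorem mul_atom_of_mem {s : Finset G} {τ : Set G} {g : G} (hg : g ∈ s) (hτ : g ∈ τ)
    (hid : ε g * ε g = ε g) : ε g * atom ε hε s τ = atom ε hε s τ := by
  classical
  rw [← Finset.insert_erase hg, atom_insert (Finset.notMem_erase g s), if_pos hτ, ← mul_assoc, hid]

theorem mul_atom_of_notMem {s : Finset G} {τ : Set G} {g : G} (hg : g ∈ s) (hτ : g ∉ τ)
    (hid : ε g * ε g = ε g) : ε g * atom ε hε s τ = 0 := by
  classical
  rw [← Finset.insert_erase hg, atom_insert (Finset.notMem_erase g s), if_neg hτ, ← mul_assoc,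
    mul_sub, hid, mul_one, sub_self, zero_mul]

/-- At some `g` the sets differ, and there `ε g` fixes one of the atom and `a` while annihilating
the other. Commuting `ε g` with the atom kills the product. -/
theorem atom_mul_eq_zero [Fintype G] (hid : ∀ g, ε g * ε g = ε g) {a : B} {τ σ : Set G}
    (h1 : ∀ g ∈ σ, ε g * a = a) (h0 : ∀ g ∉ σ, ε g * a = 0) (hne : τ ≠ σ) :
    atom ε hε Finset.univ τ * a = 0 := by
  obtain ⟨g, hg⟩ : ∃ g, ¬ (g ∈ τ ↔ g ∈ σ) := by
    by_contra! h
    exact hne (Set.ext h)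
  have hc := (commute_atom (hε := hε) (fun h => hε g h) Finset.univ τ).eq
  by_cases hτ : g ∈ τ
  · rw [← mul_atom_of_mem (Finset.mem_univ g) hτ (hid g), hc, mul_assoc,
      h0 g fun h => hg (iff_of_true hτ h), mul_zero]
  · have hσ : g ∈ σ := by
      by_contra h
      exact hg (iff_of_false hτ h)
    rw [← h1 g hσ, ← mul_assoc, ← hc, mul_atom_of_notMem (Finset.mem_univ g) hτ (hid g), zero_mul]

/-- This expands `1` as the product of the factors `ε g + (1 - ε g)`: each new `g` splits an atom
into the two that contain or omit `g`. -/
theorem one_mem_span_atom (𝕜 : Type*) [Semiring 𝕜] [Module 𝕜 B] (s : Finset G) :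
    (1 : B) ∈ Submodule.span 𝕜 (Set.range (atom ε hε s)) := by
  classical
  induction s using Finset.induction_on with
  | empty => exact Submodule.subset_span ⟨∅, atom_empty _⟩
  | insert g s hg ih =>
    refine Submodule.span_le.2 ?_ ih
    rintro _ ⟨τ, rfl⟩
    have h : atom ε hε s τ =
        atom ε hε (insert g s) (insert g τ) + atom ε hε (insert g s) (τ \ {g}) := by
      rw [atom_insert hg, atom_insert hg, if_pos (Set.mem_insert g τ), if_neg (by simp),
        atom_congr (τ := insert g τ) (σ := τ), atom_congr (τ := τ \ {g}) (σ := τ), ← add_mul,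
        add_sub_cancel, one_mul]
      all_goals
        intro h hs
        have : h ≠ g := fun e => hg (e ▸ hs)
        simp [this]
    rw [h]
    exact Submodule.add_mem _ (Submodule.subset_span ⟨_, rfl⟩) (Submodule.subset_span ⟨_, rfl⟩)

/-- Moving `b` past a factor translates its index by `k`. The induction runs over arbitrary `s`,
which is translated as well; only `univ` is invariant. -/
theorem mul_atom_smul [Group G] {b : B} {k : G} (h : ∀ g, b * ε g = ε (k * g) * b) [Fintype G]
    (τ : Set G) :
    b * atom ε hε Finset.univ τ = atom ε hε Finset.univ (k • τ) * b := by
  classical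
  have key : ∀ s : Finset G,
      b * atom ε hε s τ = atom ε hε (s.map (Equiv.mulLeft k).toEmbedding) (k • τ) * b := by
    intro s
    induction s using Finset.induction_on with
    | empty => rw [Finset.map_empty, atom_empty, atom_empty, mul_one, one_mul]
    | insert g s hg ih =>
      have hm : k * g ∈ k • τ ↔ g ∈ τ := Set.smul_mem_smul_set_iff
      rw [Finset.map_insert, atom_insert hg, atom_insert (by simpa using hg), mul_assoc, ← ih,
        ← mul_assoc, ← mul_assoc]
      congr 1
      simp only [Equiv.coe_toEmbedding, Equiv.coe_mulLeft, hm]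
      split_ifs
      · exact h g
      · rw [mul_sub, sub_mul, mul_one, one_mul, h]
  rw [key, Finset.map_univ_equiv]

end Atoms

/-! ### Atoms of a partial representation -/

namespace IsPartialRep

variable {G : Type*} [Group G] {B : Type*} [CStarAlgebra B] {π : G → B}

/-- The adjoint of the defining relation at `h⁻¹, g⁻¹`. -/
theorem inv_mul_map_mul (hπ : IsPartialRep π) (g h : G) :
    π g⁻¹ * π g * π h = π g⁻¹ * π (g * h) := by
  have := congrArg star (hπ.map_mul h⁻¹ g⁻¹)
  simp only [star_mul, ← hπ.map_inv, inv_inv, mul_inv_rev] at this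
  rw [mul_assoc, this]

theorem map_mul_proj (hπ : IsPartialRep π) (g h : G) :
    π g * (π h * π h⁻¹) = π (g * h) * π (g * h)⁻¹ * π g := by
  have := hπ.inv_mul_map_mul (g * h)⁻¹ g
  rw [inv_inv] at this
  rw [this, ← mul_assoc, hπ.map_mul, mul_inv_rev, inv_mul_cancel_right]

theorem proj_mul_map (hπ : IsPartialRep π) (g : G) : π g * π g⁻¹ * π g = π g := by
  have := hπ.map_mul g g⁻¹
  rwa [inv_inv, mul_inv_cancel, hπ.map_one, one_mul] at this

theorem proj_mul_proj (hπ : IsPartialRep π) (g : G) :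
    π g * π g⁻¹ * (π g * π g⁻¹) = π g * π g⁻¹ := by
  rw [← mul_assoc, hπ.proj_mul_map]

/-- Passing `π h * π h⁻¹` through `π g⁻¹` changes its index to `g⁻¹ * h`; passing it through `π g`
restores `h`. -/
theorem commute_proj (hπ : IsPartialRep π) (g h : G) :
    Commute (π g * π g⁻¹) (π h * π h⁻¹) := by
  change _ * _ = _ * _
  rw [mul_assoc, hπ.map_mul_proj, ← mul_assoc, hπ.map_mul_proj, mul_inv_cancel_left, mul_assoc]

theorem star_proj (hπ : IsPartialRep π) (g : G) : star (π g * π g⁻¹) = π g * π g⁻¹ := by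
  rw [star_mul, ← hπ.map_inv, ← hπ.map_inv, inv_inv]

/-- The projection on which `π g * π g⁻¹` is `1` for `g ∈ τ` and `0` for `g ∉ τ`. -/
noncomputable def atom [Fintype G] (hπ : IsPartialRep π) (τ : Set G) : B :=
  _root_.atom (fun g => π g * π g⁻¹) hπ.commute_proj Finset.univ τ

variable [Fintype G] (hπ : IsPartialRep π)

theorem proj_mul_atom {τ : Set G} {g : G} (hg : g ∈ τ) :
    π g * π g⁻¹ * hπ.atom τ = hπ.atom τ :=
  mul_atom_of_mem (ε := fun g => π g * π g⁻¹) (Finset.mem_univ g) hg (hπ.proj_mul_proj g)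

theorem commute_proj_atom (τ : Set G) (g : G) : Commute (π g * π g⁻¹) (hπ.atom τ) :=
  commute_atom (fun h => hπ.commute_proj g h) _ _

theorem atom_mul_proj {τ : Set G} {g : G} (hg : g ∈ τ) :
    hπ.atom τ * (π g * π g⁻¹) = hπ.atom τ := by
  rw [← (hπ.commute_proj_atom τ g).eq, hπ.proj_mul_atom hg]

theorem atom_mul_proj_of_notMem {τ : Set G} {g : G} (hg : g ∉ τ) :
    hπ.atom τ * (π g * π g⁻¹) = 0 := by
  rw [← (hπ.commute_proj_atom τ g).eq]
  exact mul_atom_of_notMem (ε := fun g => π g * π g⁻¹) (Finset.mem_univ g) hg (hπ.proj_mul_proj g)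

/-- The projection at `1` is the unit, so the atom has a factor `1 - 1`. -/
theorem atom_eq_zero {τ : Set G} (h : (1 : G) ∉ τ) : hπ.atom τ = 0 := by
  have := hπ.atom_mul_proj_of_notMem h
  rwa [inv_one, hπ.map_one, mul_one, mul_one] at this

theorem map_mul_atom (g : G) (τ : Set G) : π g * hπ.atom τ = hπ.atom (g • τ) * π g :=
  mul_atom_smul (fun h => hπ.map_mul_proj g h) τ

/-- The atom absorbs `π g * π g⁻¹`, and behind `π g⁻¹` the partial representation is multiplicative.
This is the composition rule of the spanning elements. -/
theorem atom_mul_map_mul_map {τ : Set G} {g : G} (hg : g ∈ τ) (h : G) :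
    hπ.atom τ * π g * π h = hπ.atom τ * π (g * h) := by
  have := hπ.inv_mul_map_mul g h
  rw [← hπ.atom_mul_proj hg]
  simp only [mul_assoc] at this ⊢
  rw [this]

theorem atom_mul_map_of_notMem {τ : Set G} {g : G} (hg : g ∉ τ) : hπ.atom τ * π g = 0 := by
  rw [← hπ.proj_mul_map g, ← mul_assoc, hπ.atom_mul_proj_of_notMem hg, zero_mul]

theorem atom_mul_atom (τ : Set G) : hπ.atom τ * hπ.atom τ = hπ.atom τ :=
  atom_mul_of_eq (fun _ hg => hπ.proj_mul_atom hg) fun g hg =>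
    mul_atom_of_notMem (ε := fun g => π g * π g⁻¹) (Finset.mem_univ g) hg (hπ.proj_mul_proj g)

/-- Reversing the ordered product is avoided: the atom `P` fixes `star P`, so `star P = P * star P`
is self-adjoint. -/
theorem star_atom (τ : Set G) : star (hπ.atom τ) = hπ.atom τ := by
  have h : hπ.atom τ * star (hπ.atom τ) = star (hπ.atom τ) := by
    refine atom_mul_of_eq (fun g hg => ?_) fun g hg => ?_
    · conv_rhs => rw [← hπ.atom_mul_proj hg, star_mul, hπ.star_proj]
    · have := congrArg star (hπ.atom_mul_proj_of_notMem hg)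
      rwa [star_mul, hπ.star_proj, star_zero] at this
  have h2 := congrArg star h
  rw [star_mul, star_star, h] at h2
  exact h2

end IsPartialRep

/-- The span contains `1`, a combination of atoms, and is invariant under generators: for `1 ∈ τ`,
`π x * P_τ * π g = P_{xτ} * π (x * g)`, because `x ∈ xτ`. -/
theorem PartialGroupCStar.span_atom_mul_of (G : Type u) [Group G] [Fintype G] :
    Submodule.span ℂ (Set.range fun p : Set G × G =>
      (isPartialRep G).atom p.1 * of p.2) = ⊤ := by
  set S := Submodule.span ℂ (Set.range fun p : Set G × G =>
      (isPartialRep G).atom p.1 * of p.2) with hS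
  have hπ := isPartialRep G
  have : FiniteDimensional ℂ S := FiniteDimensional.span_of_finite ℂ (Set.finite_range _)
  have hg : ∀ (x : G), ∀ a ∈ S, of x * a ∈ S := fun x a ha => by
    induction ha using Submodule.span_induction with
    | mem a ha =>
      obtain ⟨⟨τ, g⟩, rfl⟩ := ha
      change of x * (hπ.atom τ * of g) ∈ S
      by_cases h1 : (1 : G) ∈ τ
      · rw [← mul_assoc, hπ.map_mul_atom, hπ.atom_mul_map_mul_map (Set.mem_smul_set.2 ⟨1, h1, mul_one _⟩)]
        exact Submodule.subset_span ⟨(_, _), rfl⟩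
      · rw [hπ.atom_eq_zero h1, zero_mul, mul_zero]
        exact S.zero_mem
    | zero => rw [mul_zero]; exact S.zero_mem
    | add a b _ _ ha hb => rw [mul_add]; exact S.add_mem ha hb
    | smul c a _ ha => rw [mul_smul_comm]; exact S.smul_mem c ha
  refine UniversalCStarAlgebra.submodule_eq_top S ?_ hg fun x a ha => ?_
  · refine Submodule.span_mono ?_ (one_mem_span_atom (hε := hπ.commute_proj) ℂ Finset.univ)
    rintro _ ⟨τ, rfl⟩
    exact ⟨(τ, 1), (congrArg _ hπ.map_one).trans (mul_one _)⟩
  · have := hg x⁻¹ a ha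
    rwa [hπ.map_inv] at this

/-! ### Coset decompositions and orbits of tuples -/

namespace TupleSpace

variable {G : Type u} [Group G] {n : ℕ} {τ : TupleSpace G n}

theorem mul_mem_iff {h : G} (hh : h ∈ τ.stab) (g : G) : h * g ∈ τ.1 ↔ g ∈ τ.1 := by
  have : h • τ.1 = τ.1 := hh
  conv_lhs => rw [← this]
  exact Set.smul_mem_smul_set_iff

theorem stab_le {h : G} (hh : h ∈ τ.stab) : h ∈ τ.1 := by
  simpa using (mul_mem_iff hh 1).2 τ.2.1

instance [Finite G] : Finite (TupleSpace G n) := Subtype.finite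

instance [Finite G] : Finite (TupleOrbits G n) := Quotient.finite _

theorem le_card [Finite G] (τ : TupleSpace G n) : n ∈ Set.Icc 1 (Nat.card G) := by
  have h := (Set.toFinite τ.1).cast_ncard_eq.trans τ.2.2
  rw [Nat.cast_inj] at h
  rw [← h]
  exact ⟨(Set.ncard_pos (Set.toFinite _)).2 ⟨1, τ.2.1⟩, Set.ncard_le_card _⟩

/-- A tuple as a set with a left action of its stabilizer. -/
def subMulAction (τ : TupleSpace G n) : SubMulAction τ.stab G where
  carrier := τ.1
  smul_mem' h g hg := (mul_mem_iff h.2 g).2 hg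

/-- The stabilizer acts freely on `τ` by left multiplication, so `n` is the number of orbits times
its order. The orbits are the right cosets, and the `x j` form a transversal. -/
theorem exists_isDecomposition [Finite G] (τ : TupleSpace G n) :
    ∃ x : Fin (τ.mult + 1) → G, τ.IsDecomposition x := by
  classical
  let Q := Quotient (MulAction.orbitRel τ.stab τ.subMulAction)
  have hfree : ∀ b : τ.subMulAction, MulAction.stabilizer τ.stab b = ⊥ := fun b => by
    rw [eq_bot_iff]
    intro h hh
    have h2 : (h : G) * (b : G) = b := congrArg Subtype.val (MulAction.mem_stabilizer_iff.1 hh)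
    exact Subgroup.mem_bot.2 (Subtype.ext (mul_eq_right.1 h2))
  have hcard : n = Nat.card Q * Nat.card τ.stab := by
    have h := (Set.toFinite τ.1).cast_ncard_eq.trans τ.2.2
    rw [Nat.cast_inj] at h
    exact h.symm.trans ((Nat.card_congr (MulAction.selfEquivOrbitsQuotientProd hfree)).trans
      (Nat.card_prod _ _))
  let q0 : Q := Quotient.mk _ (⟨1, τ.2.1⟩ : τ.subMulAction)
  have hQ : Nat.card Q = τ.mult + 1 := by
    -- As there is at least one coset, the truncated subtraction in `mult` is a genuine one.
    have : Nonempty Q := ⟨q0⟩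
    have hpos : 0 < Nat.card Q := Nat.card_pos
    have : n / Nat.card τ.stab = Nat.card Q :=
      (congrArg (· / Nat.card τ.stab) hcard).trans (Nat.mul_div_cancel _ Nat.card_pos)
    rw [mult, this]
    omega
  let e₀ : Fin (τ.mult + 1) ≃ Q := ((Finite.equivFin Q).trans (finCongr hQ)).symm
  -- The swap gives the coset of `1` the index `0`, as required for `x 0 = 1`.
  let e : Fin (τ.mult + 1) ≃ Q := (Equiv.swap 0 (e₀.symm q0)).trans e₀
  have he : e 0 = q0 := by simp [e]
  obtain ⟨y, hy1, hy⟩ : ∃ y : Q → τ.subMulAction, y q0 = ⟨1, τ.2.1⟩ ∧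
      ∀ q, Quotient.mk _ (y q) = q :=
    ⟨Function.update Quotient.out q0 ⟨1, τ.2.1⟩, by simp, fun q => by
      by_cases h : q = q0
      · rw [h, Function.update_self]
      · rw [Function.update_of_ne h, Quotient.out_eq]⟩
  have key : ∀ (t : τ.subMulAction) j, (t : G) ∈ (fun h => h * (y (e j) : G)) '' (τ.stab : Set G) ↔
      e j = Quotient.mk _ t := by
    intro t j
    rw [← hy (e j), eq_comm, Quotient.eq, MulAction.orbitRel_apply, MulAction.mem_orbit_iff, hy]
    constructor
    · rintro ⟨h, hh, hht⟩
      exact ⟨⟨h, hh⟩, Subtype.ext hht⟩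
    · rintro ⟨h, hh⟩
      exact ⟨h, h.2, congrArg Subtype.val hh⟩
  refine ⟨fun j => y (e j), by simp only [he, hy1], ?_, fun j k hjk => ?_⟩
  · ext t
    rw [Set.mem_iUnion]
    constructor
    · intro ht
      obtain ⟨j, hj⟩ := e.surjective (Quotient.mk _ (⟨t, ht⟩ : τ.subMulAction))
      exact ⟨j, (key ⟨t, ht⟩ j).2 hj⟩
    · rintro ⟨j, h, hh, rfl⟩
      exact (mul_mem_iff hh _).2 (y (e j)).2
  · refine Set.disjoint_left.2 ?_
    intro t hj hk
    have ht : t ∈ τ.subMulAction := by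
      obtain ⟨h, hh, rfl⟩ := hj
      exact (mul_mem_iff hh _).2 (y (e j)).2
    exact hjk (e.injective (((key ⟨t, ht⟩ j).1 hj).trans ((key ⟨t, ht⟩ k).1 hk).symm))

namespace IsDecomposition

variable {x : Fin (τ.mult + 1) → G} (hx : τ.IsDecomposition x)

include hx

theorem mem_iff (g : G) : g ∈ τ.1 ↔ ∃ j, g * (x j)⁻¹ ∈ τ.stab := by
  rw [hx.union, Set.mem_iUnion]
  refine exists_congr fun j => ⟨?_, fun h => ⟨_, h, inv_mul_cancel_right _ _⟩⟩
  rintro ⟨h, hh, rfl⟩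
  simpa using hh

theorem eq_of_mem {g : G} {j k} (hj : g * (x j)⁻¹ ∈ τ.stab) (hk : g * (x k)⁻¹ ∈ τ.stab) :
    j = k := by
  by_contra h
  exact Set.disjoint_left.1 (hx.disjoint h) ⟨_, hj, inv_mul_cancel_right _ _⟩
    ⟨_, hk, inv_mul_cancel_right _ _⟩

/-- Thus different rows of a block belong to different atoms. -/
theorem eq_of_smul_eq {j k} (h : (x j)⁻¹ • τ.1 = (x k)⁻¹ • τ.1) : j = k := by
  have h2 : x j * (x k)⁻¹ ∈ τ.stab := by
    change (x j * (x k)⁻¹) • τ.1 = τ.1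
    rw [mul_smul, ← h, smul_inv_smul]
  exact hx.eq_of_mem (by simp) h2

end IsDecomposition

/-- Thus different blocks involve different atoms. Cardinality forces `n = m`, and then `k * g⁻¹`
moves `τ` to `σ`. -/
theorem mk_eq_of_smul_eq {m : ℕ} {σ : TupleSpace G m} {g k : G}
    (h : g⁻¹ • τ.1 = k⁻¹ • σ.1) : (⟨n, TupleOrbits.mk τ⟩ : Σ n, TupleOrbits G n) =
      ⟨m, TupleOrbits.mk σ⟩ := by
  have e := congrArg Set.encard h
  rw [Set.encard_smul_set, Set.encard_smul_set, τ.2.2, σ.2.2, Nat.cast_inj] at e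
  subst e
  congr 1
  refine Quotient.sound ⟨k * g⁻¹, ?_, Subtype.ext ?_⟩
  · change (k * g⁻¹)⁻¹ ∈ τ.1
    rw [← Set.smul_mem_smul_set_iff (a := g⁻¹), h, Set.mem_smul_set_iff_inv_smul_mem]
    simpa using σ.2.1
  · change (k * g⁻¹) • τ.1 = σ.1
    rw [mul_smul, h, smul_inv_smul]

theorem smul_eq_of_mem {a y : G} (h : a⁻¹ * y⁻¹ ∈ τ.stab) : a • τ.1 = y⁻¹ • τ.1 := by
  have h2 : (a⁻¹ * y⁻¹) • τ.1 = τ.1 := h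
  conv_lhs => rw [← h2]
  rw [smul_smul, mul_inv_cancel_left]

/-- Every pair of elements `1, g` of a subset of `G` is described by a representative of an orbit
and a decomposition of it. -/
theorem exists_eq_smul [Finite G] {s : ∀ n : ℕ, TupleOrbits G n → TupleSpace G n}
    (hs : ∀ (n : ℕ) (z : TupleOrbits G n), TupleOrbits.mk (s n z) = z)
    {x : ∀ (n : ℕ) (z : TupleOrbits G n), Fin ((s n z).mult + 1) → G}
    (hx : ∀ n z, (s n z).IsDecomposition (x n z)) {σ : Set G} (h1 : 1 ∈ σ) {g : G} (hg : g ∈ σ) :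
    ∃ (n : ℕ) (z : TupleOrbits G n) (j k : Fin ((s n z).mult + 1)) (h : (s n z).stab),
      σ = (x n z j)⁻¹ • (s n z).1 ∧ g = (x n z j)⁻¹ * h * x n z k := by
  let τ : TupleSpace G σ.ncard := ⟨σ, h1, (Set.toFinite σ).cast_ncard_eq.symm⟩
  obtain ⟨a, ha, haτ⟩ := Quotient.exact (hs _ (TupleOrbits.mk τ))
  have haσ : a • (s _ (TupleOrbits.mk τ)).1 = σ := congrArg Subtype.val haτ
  -- Since `a⁻¹` lies in the representative, `a⁻¹ = h * x j` with `h` in the stabilizer; hence `a`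
  -- and `(x j)⁻¹` translate the representative to the same set.
  obtain ⟨j, hj⟩ := ((hx _ _).mem_iff _).1 ha
  have hσ : σ = (x _ (TupleOrbits.mk τ) j)⁻¹ • (s _ (TupleOrbits.mk τ)).1 :=
    haσ.symm.trans (smul_eq_of_mem hj)
  replace hg := hσ.subset hg
  rw [Set.mem_smul_set_iff_inv_smul_mem, inv_inv, smul_eq_mul, (hx _ _).mem_iff] at hg
  obtain ⟨k, hk⟩ := hg
  exact ⟨_, TupleOrbits.mk τ, j, k, ⟨_, hk⟩, hσ, by group⟩

end TupleSpace

/-! ### The matrix representation of a decomposed tuple -/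

namespace GroupCStar

variable {G : Type u} [Group G] {H : Subgroup G}

open Classical in
/-- The canonical unitaries of a subgroup, extended by zero to the group. -/
noncomputable def extend (H : Subgroup G) (g : G) : GroupCStar H :=
  if h : g ∈ H then of ⟨g, h⟩ else 0

theorem extend_of_mem {g : G} (h : g ∈ H) : extend H g = of ⟨g, h⟩ := dif_pos h

theorem extend_of_notMem {g : G} (h : g ∉ H) : extend H g = 0 := dif_neg h

theorem extend_one : extend H 1 = 1 := by
  rw [extend_of_mem H.one_mem]
  exact (isUnitaryRep H).map_one

theorem extend_mul {g : G} (hg : g ∈ H) (k : G) :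
    extend H g * extend H k = extend H (g * k) := by
  by_cases hk : k ∈ H
  · rw [extend_of_mem hg, extend_of_mem hk, extend_of_mem (H.mul_mem hg hk),
      ← (isUnitaryRep H).map_mul]
    rfl
  · rw [extend_of_notMem hk, mul_zero, extend_of_notMem]
    rwa [H.mul_mem_cancel_left hg]

theorem extend_inv (g : G) : extend H g⁻¹ = star (extend H g) := by
  by_cases hg : g ∈ H
  · rw [extend_of_mem hg, extend_of_mem (H.inv_mem hg), ← (isUnitaryRep H).map_inv]
    rfl
  · rw [extend_of_notMem hg, extend_of_notMem (mt H.inv_mem_iff.1 hg), star_zero]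

end GroupCStar

namespace TupleSpace

open GroupCStar

variable {G : Type u} [Group G] {n : ℕ} {τ : TupleSpace G n}

/-- The matrix over the group C*-algebra of the stabilizer of `τ` which a group element defines. -/
noncomputable def matrixRep (τ : TupleSpace G n) (x : Fin (τ.mult + 1) → G) (g : G) :
    CStarMatrix (Fin (τ.mult + 1)) (Fin (τ.mult + 1)) (GroupCStar τ.stab) :=
  CStarMatrix.ofMatrix (Matrix.of fun j k => extend τ.stab (x j * g * (x k)⁻¹))

theorem matrixRep_apply (τ : TupleSpace G n) (x : Fin (τ.mult + 1) → G) (g : G) (j k) :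
    matrixRep τ x g j k = extend τ.stab (x j * g * (x k)⁻¹) := rfl

namespace IsDecomposition

variable {x : Fin (τ.mult + 1) → G} (hx : τ.IsDecomposition x)

include hx

/-- Exactly one coset contains `g`, so one term survives, and its first factor is a genuine unitary.
-/
theorem sum_extend_mul_extend {g : G} (hg : g ∈ τ.1) (k : G) :
    ∑ i, extend τ.stab (g * (x i)⁻¹) * extend τ.stab (x i * k) = extend τ.stab (g * k) := by
  obtain ⟨i, hi⟩ := (hx.mem_iff g).1 hg
  rw [Fintype.sum_eq_single i, extend_mul hi]
  · rw [← mul_assoc, inv_mul_cancel_right]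
  · intro i' hi'
    rw [extend_of_notMem fun h => hi' (hx.eq_of_mem h hi), zero_mul]

theorem extend_eq_zero {g : G} (hg : g ∉ τ.1) (i) : extend τ.stab (g * (x i)⁻¹) = 0 :=
  extend_of_notMem fun h => hg ((hx.mem_iff g).2 ⟨i, h⟩)

open Classical in
theorem matrixRep_mul_matrixRep (g h : G) (j k) :
    (matrixRep τ x g * matrixRep τ x h) j k =
      if x j * g ∈ τ.1 then extend τ.stab (x j * (g * h) * (x k)⁻¹) else 0 := by
  rw [CStarMatrix.mul_apply]
  simp only [matrixRep_apply]
  split_ifs with hg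
  · simp only [mul_assoc (x _) h]
    rw [hx.sum_extend_mul_extend hg]
    simp only [mul_assoc]
  · simp only [hx.extend_eq_zero hg, zero_mul, Finset.sum_const_zero]

theorem extend_mul_inv (j k) : extend τ.stab (x j * (x k)⁻¹) = if j = k then 1 else 0 := by
  split_ifs with h
  · rw [h, mul_inv_cancel, extend_one]
  · exact extend_of_notMem fun h' => h (hx.eq_of_mem (by simp) h')

open Classical in
theorem matrixRep_proj (g : G) (j k) :
    (matrixRep τ x g * matrixRep τ x g⁻¹) j k = if j = k ∧ x j * g ∈ τ.1 then 1 else 0 := by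
  rw [hx.matrixRep_mul_matrixRep, mul_inv_cancel, mul_one, hx.extend_mul_inv]
  split_ifs <;> grind

-- The C*-structure on matrices comes from a Hilbert module, whose inner product requires an order
-- on the coefficients; the spectral order supplies it.
noncomputable local instance (A : Type*) [CStarAlgebra A] : PartialOrder A :=
  CStarAlgebra.spectralOrder A

local instance (A : Type*) [CStarAlgebra A] : StarOrderedRing A :=
  CStarAlgebra.spectralOrderedRing A

theorem isPartialRep : IsPartialRep (matrixRep τ x) where
  map_one := by
    ext j k
    rw [matrixRep_apply, mul_one, hx.extend_mul_inv, CStarMatrix.one_apply]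
  map_inv g := by
    ext j k
    rw [CStarMatrix.star_apply, matrixRep_apply, matrixRep_apply, ← extend_inv]
    simp only [mul_inv_rev, inv_inv, mul_assoc]
  map_mul g h := by
    classical
    ext j l
    rw [hx.matrixRep_mul_matrixRep, CStarMatrix.mul_apply]
    simp only [hx.matrixRep_mul_matrixRep, matrixRep_apply]
    -- The row condition on the right concerns `x j * (g * h)`, not `x j * g`. If `x j * g ∉ τ`, the
    -- right side still vanishes, because its entry is built from `x j * (g * h * h⁻¹)`.
    have key : x j * (g * h * h⁻¹) = x j * g := by rw [mul_inv_cancel_right]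
    by_cases hg : x j * g ∈ τ.1
    · simp only [if_pos hg, mul_assoc (x _) h⁻¹]
      split_ifs with hgh
      · rw [hx.sum_extend_mul_extend hgh]
        simp only [mul_assoc]
      · simp only [hx.extend_eq_zero hgh, zero_mul, Finset.sum_const_zero]
    · simp only [if_neg hg, zero_mul, Finset.sum_const_zero]
      rw [key, hx.extend_eq_zero hg, ite_self]

/-- The *-homomorphism from the partial group C*-algebra which a decomposed tuple defines. -/
noncomputable def hom : PartialGroupCStar G →⋆ₐ[ℂ]
    CStarMatrix (Fin (τ.mult + 1)) (Fin (τ.mult + 1)) (GroupCStar τ.stab) :=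
  UniversalCStarAlgebra.lift (R := partialRepRelations G) ⟨_, matrixRep τ x, hx.isPartialRep⟩

theorem hom_of (g : G) : hx.hom (PartialGroupCStar.of g) = matrixRep τ x g :=
  UniversalCStarAlgebra.lift_gen (R := partialRepRelations G)
    ⟨_, matrixRep τ x, hx.isPartialRep⟩ g

-- On the diagonal matrix unit `e` at `k`, each projection acts as `1` or `0` according to
-- membership of its index in `(x k)⁻¹ • τ`. Hence the atom of `σ` fixes or kills `e`, which
-- determines its column `k`.
open Classical in
theorem hom_atom [Fintype G] (σ : Set G) (j k) :
    hx.hom ((PartialGroupCStar.isPartialRep G).atom σ) j k =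
      if σ = (x k)⁻¹ • τ.1 ∧ j = k then 1 else 0 := by
  have hm : ∀ g, g ∈ (x k)⁻¹ • τ.1 ↔ x k * g ∈ τ.1 := fun g => by
    rw [Set.mem_smul_set_iff_inv_smul_mem, inv_inv, smul_eq_mul]
  let e : CStarMatrix (Fin (τ.mult + 1)) (Fin (τ.mult + 1)) (GroupCStar τ.stab) :=
    CStarMatrix.ofMatrix (Matrix.single k k 1)
  have he : ∀ i l, e i l = if k = i ∧ k = l then 1 else 0 := fun i l => Matrix.single_apply ..
  have hmul : ∀ (a : CStarMatrix (Fin (τ.mult + 1)) (Fin (τ.mult + 1)) (GroupCStar τ.stab)) i l,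
      (a * e) i l = if k = l then a i k else 0 := fun a i l => by
    simp [CStarMatrix.mul_apply, he, ite_and]
  have h1 : ∀ g ∈ (x k)⁻¹ • τ.1, matrixRep τ x g * matrixRep τ x g⁻¹ * e = e := fun g hg => by
    ext i l
    rw [hmul, hx.matrixRep_proj, he]
    have := (hm g).1 hg
    grind
  have h0 : ∀ g ∉ (x k)⁻¹ • τ.1, matrixRep τ x g * matrixRep τ x g⁻¹ * e = 0 := fun g hg => by
    ext i l
    rw [hmul, hx.matrixRep_proj, CStarMatrix.zero_apply]
    have := mt (hm g).2 hg
    grind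
  have hA : hx.hom ((PartialGroupCStar.isPartialRep G).atom σ) = hx.isPartialRep.atom σ :=
    map_atom hx.hom hx.isPartialRep.commute_proj
      (fun g => by rw [map_mul, hx.hom_of, hx.hom_of]) _ _
  have hB : (hx.isPartialRep.atom σ * e) j k = hx.isPartialRep.atom σ j k := by
    rw [hmul, if_pos rfl]
  rw [hA, ← hB]
  by_cases hσ : σ = (x k)⁻¹ • τ.1
  · rw [IsPartialRep.atom, hσ, atom_mul_of_eq h1 h0, he]
    grind
  · rw [IsPartialRep.atom, atom_mul_eq_zero hx.isPartialRep.proj_mul_proj h1 h0 hσ]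
    simp [hσ]

open Classical in
theorem hom_atom_mul_of [Fintype G] (σ : Set G) (g : G) (j k) :
    hx.hom ((PartialGroupCStar.isPartialRep G).atom σ * PartialGroupCStar.of g) j k =
      if σ = (x j)⁻¹ • τ.1 then extend τ.stab (x j * g * (x k)⁻¹) else 0 := by
  rw [map_mul, hx.hom_of, CStarMatrix.mul_apply, Fintype.sum_eq_single j, hx.hom_atom,
    matrixRep_apply]
  · split_ifs <;> simp_all
  · intro i hi
    rw [hx.hom_atom, if_neg fun h => hi h.2.symm, zero_mul]

end IsDecomposition

end TupleSpace

/-! ### The corner of a stabilizer -/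

namespace IsPartialRep

variable {G : Type u} [Group G] [Fintype G] {B : Type*} [CStarAlgebra B] {π : G → B}

/-- Elements of the stabilizer fix `τ`, so their images commute with the atom, and they lie in `τ`,
so they multiply correctly on it. The summand `1 - P` makes the map unital, as the universal
property demands. -/
theorem isUnitaryRep_atom (hπ : IsPartialRep π) {n : ℕ} (τ : TupleSpace G n) :
    IsUnitaryRep fun h : τ.stab => hπ.atom τ.1 * π h + (1 - hπ.atom τ.1) := by
  have hc : ∀ h : τ.stab, π h * hπ.atom τ.1 = hπ.atom τ.1 * π h := fun h => by
    rw [hπ.map_mul_atom, show (h : G) • τ.1 = τ.1 from h.2]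
  have hP := hπ.atom_mul_atom τ.1
  have hm : ∀ g h : τ.stab, hπ.atom τ.1 * π (g * h) = hπ.atom τ.1 * π g * π h := fun g h =>
    (hπ.atom_mul_map_mul_map (TupleSpace.stab_le g.2) h).symm
  have h1 : hπ.atom τ.1 * π (1 : τ.stab) + (1 - hπ.atom τ.1) = 1 := by
    rw [OneMemClass.coe_one, hπ.map_one, mul_one, add_sub_cancel]
  have hmul : ∀ g h : τ.stab, hπ.atom τ.1 * π (g * h : τ.stab) + (1 - hπ.atom τ.1) =
      (hπ.atom τ.1 * π g + (1 - hπ.atom τ.1)) * (hπ.atom τ.1 * π h + (1 - hπ.atom τ.1)) :=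
    fun g h => by
      have e1 : hπ.atom τ.1 * π g * (hπ.atom τ.1 * π h) = hπ.atom τ.1 * π g * π h := by
        rw [mul_assoc, ← mul_assoc (π g), hc, ← mul_assoc, ← mul_assoc, hP]
      have e2 : hπ.atom τ.1 * π g * (1 - hπ.atom τ.1) = 0 := by
        rw [mul_sub, mul_one, mul_assoc, hc, ← mul_assoc, hP, sub_self]
      have e3 : (1 - hπ.atom τ.1) * (hπ.atom τ.1 * π h) = 0 := by
        rw [sub_mul, one_mul, ← mul_assoc, hP, sub_self]
      have e4 : (1 - hπ.atom τ.1) * (1 - hπ.atom τ.1) = 1 - hπ.atom τ.1 :=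
        IsIdempotentElem.one_sub hP
      rw [add_mul, mul_add, mul_add, e1, e2, e3, e4, add_zero, zero_add, Subgroup.coe_mul, hm]
  have hstar : ∀ h : τ.stab, star (hπ.atom τ.1 * π h + (1 - hπ.atom τ.1)) =
      hπ.atom τ.1 * π (h⁻¹ : τ.stab) + (1 - hπ.atom τ.1) := fun h => by
    rw [star_add, star_mul, star_sub, hπ.star_atom, star_one, ← hπ.map_inv, ← Subgroup.coe_inv, hc]
  refine ⟨h1, hmul, fun h => Unitary.mem_iff.2 ⟨?_, ?_⟩⟩
  · rw [hstar, ← hmul, inv_mul_cancel, h1]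
  · rw [hstar, ← hmul, mul_inv_cancel, h1]

end IsPartialRep

theorem Submodule.eq_top_of_single_mem {R ι : Type*} [Semiring R] [Finite ι] [DecidableEq ι]
    {M : ι → Type*} [∀ i, AddCommMonoid (M i)] [∀ i, Module R (M i)] (S : Submodule R (∀ i, M i))
    (h : ∀ i a, Pi.single i a ∈ S) : S = ⊤ := by
  have := Fintype.ofFinite ι
  refine Submodule.eq_top_iff'.2 fun f => ?_
  rw [← Finset.univ_sum_single f]
  exact S.sum_mem fun i _ => h i _

/-! ### Bijectivity and uniqueness -/

namespace PartialGroupCStar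

open Classical

variable {G : Type u} [Group G] {s : ∀ n : ℕ, TupleOrbits G n → TupleSpace G n}
  {x : ∀ (n : ℕ) (z : TupleOrbits G n), Fin ((s n z).mult + 1) → G}

/-- The direct sum of the *-homomorphisms which the decomposed representatives define. -/
noncomputable def toPi (hx : ∀ n z, (s n z).IsDecomposition (x n z)) : PartialGroupCStar G →⋆ₐ[ℂ]
    (∀ (n : Set.Icc 1 (Nat.card G)) (z : TupleOrbits G n),
      CStarMatrix (Fin ((s n z).mult + 1)) (Fin ((s n z).mult + 1)) (GroupCStar (s n z).stab)) where
  toFun a n z := (hx n z).hom a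
  map_one' := by ext1 n; ext1 z; exact map_one _
  map_mul' a b := by ext1 n; ext1 z; exact map_mul _ a b
  map_zero' := by ext1 n; ext1 z; exact map_zero _
  map_add' a b := by ext1 n; ext1 z; exact map_add _ a b
  commutes' c := by ext1 n; ext1 z; exact AlgHomClass.commutes _ c
  map_star' a := by ext1 n; ext1 z; exact map_star _ a

variable [Fintype G]

/-- The element which corresponds to the unitary of `h` in the entry `(j, k)` of the matrices over
the group C*-algebra of the stabilizer of `τ`. -/
noncomputable def matrixUnit {n : ℕ} {τ : TupleSpace G n} (x : Fin (τ.mult + 1) → G)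
    (j k : Fin (τ.mult + 1)) (h : τ.stab) : PartialGroupCStar G :=
  (isPartialRep G).atom ((x j)⁻¹ • τ.1) * of ((x j)⁻¹ * h * x k)

/-- The atom selects row `j`. There the entry at `k'` comes from `h * x k * (x k')⁻¹`, which lies in
the stabilizer only for `k' = k`. -/
theorem hom_matrixUnit {n : ℕ} {τ : TupleSpace G n} {x : Fin (τ.mult + 1) → G}
    (hx : τ.IsDecomposition x) (j k : Fin (τ.mult + 1)) (h : τ.stab) :
    hx.hom (matrixUnit x j k h) =
      CStarMatrix.ofMatrix (Matrix.single j k (GroupCStar.of h)) := by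
  ext j' k'
  have hm : ((h : G) * (x k * (x k')⁻¹) ∈ τ.stab) ↔ k = k' := by
    rw [τ.stab.mul_mem_cancel_left h.2]
    refine ⟨fun h' => hx.eq_of_mem (by simp) h', fun e => ?_⟩
    rw [e, mul_inv_cancel]
    exact τ.stab.one_mem
  refine (hx.hom_atom_mul_of _ _ j' k').trans (Eq.trans ?_ (Matrix.single_apply ..).symm)
  by_cases hj : j = j'
  · subst hj
    have e : x j * ((x j)⁻¹ * h * x k) * (x k')⁻¹ = h * (x k * (x k')⁻¹) := by group
    rw [if_pos rfl, e]
    by_cases hk : k = k'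
    · subst hk
      rw [if_pos ⟨rfl, rfl⟩, mul_inv_cancel, mul_one, GroupCStar.extend_of_mem h.2]
    · rw [if_neg fun h => hk h.2, GroupCStar.extend_of_notMem (mt hm.1 hk)]
  · rw [if_neg fun e => hj (hx.eq_of_smul_eq e), if_neg fun h => hj h.1]

theorem hom_matrixUnit_of_ne {n m : ℕ} {τ : TupleSpace G n} {x : Fin (τ.mult + 1) → G}
    {σ : TupleSpace G m} {y : Fin (σ.mult + 1) → G} (hy : σ.IsDecomposition y)
    (hne : (⟨n, TupleOrbits.mk τ⟩ : Σ n, TupleOrbits G n) ≠ ⟨m, TupleOrbits.mk σ⟩)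
    (j k : Fin (τ.mult + 1)) (h : τ.stab) : hy.hom (matrixUnit x j k h) = 0 := by
  ext j' k'
  refine (hy.hom_atom_mul_of _ _ j' k').trans (if_neg fun e => ?_)
  exact hne (TupleSpace.mk_eq_of_smul_eq e)

theorem toPi_matrixUnit (hs : ∀ (n : ℕ) (z : TupleOrbits G n), TupleOrbits.mk (s n z) = z)
    (hx : ∀ n z, (s n z).IsDecomposition (x n z)) (n : Set.Icc 1 (Nat.card G))
    (z : TupleOrbits G n) (j k : Fin ((s n z).mult + 1)) (h : (s n z).stab) :
    toPi hx (matrixUnit (x n z) j k h) =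
      Pi.single n (Pi.single z (CStarMatrix.ofMatrix (Matrix.single j k (GroupCStar.of h)))) := by
  funext n' z'
  change (hx n' z').hom _ = _
  by_cases hn : n' = n
  · subst hn
    rw [Pi.single_eq_same]
    by_cases hz : z' = z
    · subst hz
      rw [Pi.single_eq_same, hom_matrixUnit]
    · rw [Pi.single_eq_of_ne hz, hom_matrixUnit_of_ne]
      rw [hs, hs]
      intro e
      exact hz (eq_of_heq (Sigma.mk.inj e).2).symm
  · rw [Pi.single_eq_of_ne hn, hom_matrixUnit_of_ne]
    · rfl
    · intro e
      exact hn (Subtype.ext (Sigma.mk.inj e).1.symm)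

/-- By linearity it suffices to reach one entry of one block, and there the unitaries `v_h`, which
span the coefficient algebra. -/
theorem toPi_surjective (hs : ∀ (n : ℕ) (z : TupleOrbits G n), TupleOrbits.mk (s n z) = z)
    (hx : ∀ n z, (s n z).IsDecomposition (x n z)) : Function.Surjective (toPi hx) := by
  let L := (toPi hx).toAlgHom.toLinearMap
  suffices h : LinearMap.range L = ⊤ from LinearMap.range_eq_top.1 h
  refine Submodule.eq_top_of_single_mem _ fun n a => ?_
  suffices h : (LinearMap.range L).comap (LinearMap.single ℂ _ n) = ⊤ from
    (h ▸ Submodule.mem_top : a ∈ (LinearMap.range L).comap (LinearMap.single ℂ _ n))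
  refine Submodule.eq_top_of_single_mem _ fun z M => ?_
  let f (j k) : GroupCStar (s n z).stab →ₗ[ℂ] CStarMatrix (Fin ((s n z).mult + 1))
      (Fin ((s n z).mult + 1)) (GroupCStar (s n z).stab) :=
    Matrix.singleLinearMap ℂ j k
  let T := ((LinearMap.range L).comap (LinearMap.single ℂ _ n)).comap (LinearMap.single ℂ _ z)
  have hf : ∀ j k a, f j k a ∈ T := fun j k a => by
    suffices h : T.comap (f j k) = ⊤ from (h ▸ Submodule.mem_top : a ∈ T.comap (f j k))
    rw [eq_top_iff, ← GroupCStar.span_of, Submodule.span_le]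
    rintro _ ⟨h, rfl⟩
    exact ⟨_, toPi_matrixUnit hs hx n z j k h⟩
  have hM : M = ∑ j, ∑ k, f j k (M j k) := Matrix.matrix_eq_sum_single M
  change M ∈ T
  rw [hM]
  exact T.sum_mem fun j _ => T.sum_mem fun k _ => hf j k _

theorem span_matrixUnit (hs : ∀ (n : ℕ) (z : TupleOrbits G n), TupleOrbits.mk (s n z) = z)
    (hx : ∀ n z, (s n z).IsDecomposition (x n z)) :
    Submodule.span ℂ {a | ∃ (n : Set.Icc 1 (Nat.card G)) (z : TupleOrbits G n) (j k : _)
      (h : (s n z).stab), matrixUnit (x n z) j k h = a} = ⊤ := by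
  rw [eq_top_iff, ← span_atom_mul_of, Submodule.span_le]
  rintro _ ⟨⟨σ, g⟩, rfl⟩
  have hπ := isPartialRep G
  change hπ.atom σ * of g ∈ _
  by_cases h1 : (1 : G) ∈ σ
  · by_cases hg : g ∈ σ
    · obtain ⟨n, z, j, k, h, rfl, rfl⟩ := TupleSpace.exists_eq_smul hs hx h1 hg
      exact Submodule.subset_span ⟨⟨n, (s n z).le_card⟩, z, j, k, h, rfl⟩
    · rw [hπ.atom_mul_map_of_notMem hg]
      exact Submodule.zero_mem _
  · rw [hπ.atom_eq_zero h1, zero_mul]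
    exact Submodule.zero_mem _

/-- The *-homomorphism from the group C*-algebra of the stabilizer of a tuple which extends
the compression of the canonical partial representation. -/
noncomputable def ofStab {n : ℕ} (τ : TupleSpace G n) :
    GroupCStar τ.stab →⋆ₐ[ℂ] PartialGroupCStar G :=
  UniversalCStarAlgebra.lift (R := unitaryRepRelations τ.stab)
    ⟨_, _, (isPartialRep G).isUnitaryRep_atom τ⟩

/-- The left side is the term for entry `(j, k)` in the reconstruction formula behind injectivity.
The atom removes the summand `1 - P`, and the composition rule merges the three group elements. -/
theorem of_mul_ofStab_mul_of {n : ℕ} {τ : TupleSpace G n} (x : Fin (τ.mult + 1) → G)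
    (j k : Fin (τ.mult + 1)) (h : τ.stab) :
    of (x j)⁻¹ * ((isPartialRep G).atom τ.1 * ofStab τ (GroupCStar.of h)) * of (x k) =
      matrixUnit x j k h := by
  have hπ := isPartialRep G
  have e : ofStab τ (GroupCStar.of h) = hπ.atom τ.1 * of (h : G) + (1 - hπ.atom τ.1) :=
    UniversalCStarAlgebra.lift_gen (R := unitaryRepRelations τ.stab)
      ⟨_, _, (isPartialRep G).isUnitaryRep_atom τ⟩ h
  have h1 : (x j)⁻¹ ∈ (x j)⁻¹ • τ.1 := Set.mem_smul_set.2 ⟨1, τ.2.1, mul_one _⟩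
  have h2 : (x j)⁻¹ * h ∈ (x j)⁻¹ • τ.1 :=
    Set.mem_smul_set.2 ⟨h, TupleSpace.stab_le h.2, rfl⟩
  rw [e, mul_add, mul_sub, ← mul_assoc, hπ.atom_mul_atom, mul_one, sub_self, add_zero, ← mul_assoc,
    hπ.map_mul_atom, hπ.atom_mul_map_mul_map h1, hπ.atom_mul_map_mul_map h2]
  rfl

theorem toPi_injective (hs : ∀ (n : ℕ) (z : TupleOrbits G n), TupleOrbits.mk (s n z) = z)
    (hx : ∀ n z, (s n z).IsDecomposition (x n z)) : Function.Injective (toPi hx) := by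
  have := fun n : ℕ => Fintype.ofFinite (TupleOrbits G n)
  have hπ := isPartialRep G
  -- An explicit left inverse. Both sides are linear in `a`, so it is enough to check the spanning
  -- elements, for which a single term is nonzero.
  have key : ∀ a : PartialGroupCStar G, a = ∑ n : Set.Icc 1 (Nat.card G), ∑ z : TupleOrbits G n,
      ∑ j, ∑ k, of (x n z j)⁻¹ * (hπ.atom (s n z).1 * ofStab (s n z) (toPi hx a n z j k)) *
        of (x n z k) := by
    intro a
    have ha : a ∈ (⊤ : Submodule ℂ (PartialGroupCStar G)) := Submodule.mem_top
    rw [← span_matrixUnit hs hx] at ha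
    induction ha using Submodule.span_induction with
    | mem a ha =>
      obtain ⟨n, z, j, k, h, rfl⟩ := ha
      rw [toPi_matrixUnit hs hx, Fintype.sum_eq_single n, Fintype.sum_eq_single z,
        Fintype.sum_eq_single j, Fintype.sum_eq_single k, Pi.single_eq_same, Pi.single_eq_same,
        CStarMatrix.ofMatrix_apply, Matrix.single_apply_same, of_mul_ofStab_mul_of]
      · intro k' hk
        rw [Pi.single_eq_same, Pi.single_eq_same, CStarMatrix.ofMatrix_apply,
          Matrix.single_apply_of_ne _ _ _ _ _ (fun e => hk e.2.symm), map_zero, mul_zero, mul_zero,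
          zero_mul]
      · intro j' hj
        refine Finset.sum_eq_zero fun k' _ => ?_
        rw [Pi.single_eq_same, Pi.single_eq_same, CStarMatrix.ofMatrix_apply,
          Matrix.single_apply_of_ne _ _ _ _ _ (fun e => hj e.1.symm), map_zero, mul_zero, mul_zero,
          zero_mul]
      · intro z' hz
        refine Finset.sum_eq_zero fun j' _ => Finset.sum_eq_zero fun k' _ => ?_
        rw [Pi.single_eq_same, Pi.single_eq_of_ne hz, CStarMatrix.zero_apply, map_zero, mul_zero,
          mul_zero, zero_mul]
      · intro n' hn
        refine Finset.sum_eq_zero fun z' _ => Finset.sum_eq_zero fun j' _ =>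
          Finset.sum_eq_zero fun k' _ => ?_
        rw [Pi.single_eq_of_ne hn, Pi.zero_apply, CStarMatrix.zero_apply, map_zero, mul_zero,
          mul_zero, zero_mul]
    | zero => simp
    | add a b _ _ ha hb =>
      conv_lhs => rw [ha, hb]
      simp only [map_add, Pi.add_apply, CStarMatrix.add_apply, mul_add, add_mul,
        Finset.sum_add_distrib]
    | smul c a _ ha =>
      conv_lhs => rw [ha]
      simp only [map_smul, Pi.smul_apply, CStarMatrix.smul_apply, mul_smul_comm, smul_mul_assoc,
        Finset.smul_sum]
  intro a b hab
  rw [key a, key b, hab]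

/-- No continuity is needed, and `B` has no topology: the equalizer is a subspace of a
finite-dimensional algebra, contains `1` and is invariant under generators. -/
theorem starAlgEquiv_ext {B : Type*} [Semiring B] [Star B] [Algebra ℂ B]
    {Φ Ψ : PartialGroupCStar G ≃⋆ₐ[ℂ] B} (h : ∀ g, Φ (of g) = Ψ (of g)) : Φ = Ψ := by
  have hfin : FiniteDimensional ℂ (PartialGroupCStar G) := by
    rw [FiniteDimensional, Module.finite_def, ← span_atom_mul_of G]
    exact Submodule.fg_span (Set.finite_range _)
  let Φ' : PartialGroupCStar G →ₐ[ℂ] B := Φ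
  let Ψ' : PartialGroupCStar G →ₐ[ℂ] B := Ψ
  have hg : ∀ g, ∀ a ∈ LinearMap.eqLocus Φ'.toLinearMap Ψ'.toLinearMap,
      of g * a ∈ LinearMap.eqLocus Φ'.toLinearMap Ψ'.toLinearMap := fun g a ha => by
    change Φ' (of g * a) = Ψ' (of g * a)
    rw [map_mul, map_mul, show Φ' a = Ψ' a from ha, show Φ' (of g) = Ψ' (of g) from h g]
  have htop := UniversalCStarAlgebra.submodule_eq_top
    (LinearMap.eqLocus Φ'.toLinearMap Ψ'.toLinearMap)
    ((map_one Φ').trans (map_one Ψ').symm) hg fun g a ha => by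
      have := hg g⁻¹ a ha
      rwa [(isPartialRep G).map_inv] at this
  ext a
  exact (htop ▸ Submodule.mem_top : a ∈ LinearMap.eqLocus Φ'.toLinearMap Ψ'.toLinearMap)

end PartialGroupCStar

open Classical in
theorem mainTheorem7 {G : Type u} [Group G] [Finite G]
    (s : ∀ n : ℕ, TupleOrbits G n → TupleSpace G n)
    (hs : ∀ (n : ℕ) (z : TupleOrbits G n), TupleOrbits.mk (s n z) = z) :
    (∃ x : ∀ (n : ℕ) (z : TupleOrbits G n), Fin ((s n z).mult + 1) → G,
      ∀ n z, (s n z).IsDecomposition (x n z)) ∧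
    ∀ x : ∀ (n : ℕ) (z : TupleOrbits G n), Fin ((s n z).mult + 1) → G,
      (∀ n z, (s n z).IsDecomposition (x n z)) →
      ∃! Φ : PartialGroupCStar G ≃⋆ₐ[ℂ]
          (∀ (n : Set.Icc 1 (Nat.card G)) (z : TupleOrbits G n),
            CStarMatrix (Fin ((s n z).mult + 1)) (Fin ((s n z).mult + 1))
              (GroupCStar (s n z).stab)),
        ∀ (g : G) (n : Set.Icc 1 (Nat.card G)) (z : TupleOrbits G n)
          (j k : Fin ((s n z).mult + 1)),
          Φ (PartialGroupCStar.of g) n z j k =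
            if h : x n z j * g * (x n z k)⁻¹ ∈ (s n z).stab then
              GroupCStar.of ⟨x n z j * g * (x n z k)⁻¹, h⟩
            else 0 := by
  have := Fintype.ofFinite G
  choose x₀ hx₀ using fun n (z : TupleOrbits G n) => (s n z).exists_isDecomposition
  refine ⟨⟨x₀, hx₀⟩, fun x hx => ?_⟩
  refine ⟨StarAlgEquiv.ofBijective (PartialGroupCStar.toPi hx)
    ⟨PartialGroupCStar.toPi_injective hs hx, PartialGroupCStar.toPi_surjective hs hx⟩,
    fun g n z j k => ?_, fun Ψ hΨ => PartialGroupCStar.starAlgEquiv_ext fun g => ?_⟩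
  -- The case distinction in the statement is `extend` by definition.
  · exact congrFun (congrFun ((hx n z).hom_of g) j) k
  · funext n z
    ext j k
    rw [hΨ]
    exact (congrFun (congrFun ((hx n z).hom_of g) j) k).symm
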